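/- Let $M$ be a smooth manifold of dimension $4n$ with an almost hypercomplex structure $H=(J_1,J_2,J_3)$, i.e. smooth $(1,1)$-tensor fields with $J_\alpha=J_\beta\circ J_\gamma=-J_\gamma\circ J_\beta$ and $J_\alpha^2=-I$ for all cyclic permutations $(\alpha,\beta,\gamma)$ of $(1,2,3)$, and a pseudo-Riemannian metric $g$ with $g(x,y)=\varepsilon_\alpha g(J_\alpha x,J_\alpha y)$, where $\varepsilon_1=1$, $\varepsilon_2=\varepsilon_3=-1$ (an almost $(H,G)$-manifold). Let $\nabla$ be the Levi-Civita connection of $g$, and let $D$ be the linear connection $$D_yz=\nabla_yz+\tfrac14\sum_{\alpha=1}^{3}(\nabla_yJ_\alpha)J_\alpha z .$$ Let $R(x,y)z=\nabla_x\nabla_yz-\nabla_y\nabla_xz-\nabla_{[x,y]}z$ and $K(x,y)z=D_xD_yz-D_yD_xz-D_{[x,y]}z$ be the curvatures of $\nabla$ and $D$, and put $R(x,y,z,w)=g(R(x,y)z,w)$, $K(x,y,z,w)=g(K(x,y)z,w)$. For a $(0,4)$-tensor $L$ write $(L\circ J_\alpha)(x,y,z,w)=L(x,y,J_\alpha z,J_\alpha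 w)$. Then $$K=\tfrac14\{R+R\circ J_1-R\circ J_2-R\circ J_3\}+\tfrac1{16}P,$$ where $$P=\sum_{\alpha=1}^{3}\sum_{\beta=1}^{3}P_{\alpha\beta}-4\sum_{\alpha=1}^{3}P_{\alpha\alpha},$$ $$P_{\alpha\beta}(x,y,z,w)=g\bigl((\nabla_xJ_\alpha)J_\alpha z,(\nabla_yJ_\beta)J_\beta w\bigr)-g\bigl((\nabla_yJ_\alpha)J_\alpha z,(\nabla_xJ_\beta)J_\beta w\bigr).$$ -/

import Mathlib

open Bundle
open scoped Manifold ContDiff Topology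

noncomputable section

namespace HGManifold

variable {E : Type*} [NormedAddCommGroup E] [NormedSpace ℝ E]
  {H : Type*} [TopologicalSpace H] (I : ModelWithCorners ℝ E H)
  (M : Type*) [TopologicalSpace M] [ChartedSpace H M]

/-- The signs `ε₁ = 1`, `ε₂ = ε₃ = -1`. The index `α = 1, 2, 3` is encoded as
`0, 1, 2 : Fin 3`. -/
def epsilon : Fin 3 → ℝ := ![1, -1, -1]

/-- A smooth tensor field of type `(1,1)`: a smooth section of `End(TM)`. -/
structure EndoField [IsManifold I ∞ M] where
  /-- The endomorphism of each tangent space. -/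
  toFun (p : M) : TangentSpace I p →L[ℝ] TangentSpace I p
  smooth : ContMDiff I (I.prod 𝓘(ℝ, E →L[ℝ] E)) ∞
    (fun p ↦ TotalSpace.mk' (E →L[ℝ] E)
      (E := fun p : M ↦ TangentSpace I p →L[ℝ] TangentSpace I p) p (toFun p))

/-- A pseudo-Riemannian metric: a smooth field of nondegenerate symmetric bilinear forms on the
tangent spaces. -/
structure PseudoMetric [IsManifold I ∞ M] where
  /-- The scalar product on each tangent space. -/
  toFun (p : M) : TangentSpace I p →L[ℝ] TangentSpace I p →L[ℝ] ℝ
  smooth : ContMDiff I (I.prod 𝓘(ℝ, E →L[ℝ] E →L[ℝ] ℝ)) ∞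
    (fun p ↦ TotalSpace.mk' (E →L[ℝ] E →L[ℝ] ℝ)
      (E := fun p : M ↦ TangentSpace I p →L[ℝ] TangentSpace I p →L[ℝ] ℝ) p (toFun p))
  symm (p : M) (x y : TangentSpace I p) : toFun p x y = toFun p y x
  nondegenerate (p : M) (x : TangentSpace I p) (hx : ∀ y, toFun p x y = 0) : x = 0

/-- An almost hypercomplex structure `(J₁, J₂, J₃)` with a pseudo-Riemannian metric `g` that is
Hermitian with respect to `J₁` and anti-Hermitian (Norden) with respect to `J₂` and `J₃`.
Addition in `Fin 3` is modulo 3, so `(α, α + 1, α + 2)` runs over the cyclic permutations. The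
associated forms `g_α(x, y) = g(J_α x, y)` are determined by `J` and `g`. -/
structure AlmostHG [IsManifold I ∞ M] where
  /-- The almost complex structures `J₁, J₂, J₃`. -/
  J : Fin 3 → EndoField I M
  /-- The metric. -/
  g : PseudoMetric I M
  J_comp (α : Fin 3) (p : M) :
    (J α).toFun p = (J (α + 1)).toFun p ∘L (J (α + 2)).toFun p
  J_comp' (α : Fin 3) (p : M) :
    (J α).toFun p = -((J (α + 2)).toFun p ∘L (J (α + 1)).toFun p)
  J_sq (α : Fin 3) (p : M) :
    (J α).toFun p ∘L (J α).toFun p = -ContinuousLinearMap.id ℝ (TangentSpace I p)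
  g_J (α : Fin 3) (p : M) (x y : TangentSpace I p) :
    g.toFun p x y = epsilon α * g.toFun p ((J α).toFun p x) ((J α).toFun p y)

variable {I M}

/-- The vector field `J V`. -/
def EndoField.app [IsManifold I ∞ M] (J : EndoField I M) (V : Π p : M, TangentSpace I p) :
    Π p : M, TangentSpace I p :=
  fun p ↦ J.toFun p (V p)

variable (I) in
/-- The vector field `V` is smooth on `U`. -/
def IsSmoothOn [IsManifold I ∞ M] (V : Π p : M, TangentSpace I p) (U : Set M) : Prop :=
  ContMDiffOn I (I.prod 𝓘(ℝ, E)) ∞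
    (fun p ↦ TotalSpace.mk' E (E := (TangentSpace I : M → Type _)) p (V p)) U

/-- The function `g(V, W)`. -/
def PseudoMetric.app [IsManifold I ∞ M] (g : PseudoMetric I M)
    (V W : Π p : M, TangentSpace I p) : M → ℝ :=
  fun p ↦ g.toFun p (V p) (W p)

/-- `∇` is the Levi-Civita connection of `g`: a smooth linear connection (it maps smooth vector
fields on an open set to smooth tensor fields on that set) which is torsion free and satisfies
`x g(V, W) = g(∇_x V, W) + g(V, ∇_x W)`. In Mathlib's notation `∇ V p x` is `(∇_x V)(p)`. -/
structure IsLeviCivita [FiniteDimensional ℝ E] [IsManifold I ∞ M] (g : PseudoMetric I M)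
    (nabla : CovariantDerivative I E (TangentSpace I : M → Type _)) : Prop where
  smooth (U : Set M) (hU : IsOpen U) : ContMDiffCovariantDerivativeOn E ∞ nabla.toFun U
  torsion_free : haveI := FiniteDimensional.complete ℝ E; nabla.torsion = 0
  metric (p : M) (V W : Π p : M, TangentSpace I p) (hV : MDiffAt (T% V) p)
    (hW : MDiffAt (T% W) p) (x : TangentSpace I p) :
    d% (g.app V W) p x = g.toFun p (nabla V p x) (W p) + g.toFun p (V p) (nabla W p x)

theorem EndoField.mdiffAt_app [IsManifold I ∞ M] (J : EndoField I M)
    {V : Π p : M, TangentSpace I p} {p : M} (hV : MDiffAt (T% V) p) :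
    MDiffAt (T% (J.app V)) p :=
  MDifferentiableAt.clm_bundle_apply (b := fun q : M ↦ q)
    ((J.smooth p).mdifferentiableAt (by simp)) hV

/-- The value of `∇(J V) - J ∇V` at `p` depends only on the value of `V` at `p`. -/
theorem tensorialAt_covDeriv [IsManifold I ∞ M]
    (nabla : CovariantDerivative I E (TangentSpace I : M → Type _)) (J : EndoField I M) (p : M) :
    TensorialAt I E (fun V : Π q : M, TangentSpace I q ↦
      nabla (J.app V) p - J.toFun p ∘L nabla V p) p where
  smul {f V} hf hV := by
    have h : J.app (f • V) = f • J.app V := by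
      funext q
      simp [EndoField.app]
    ext x
    simp [h, nabla.isCovariantDerivativeOnUniv.leibniz hV hf,
      nabla.isCovariantDerivativeOnUniv.leibniz (J.mdiffAt_app hV) hf, EndoField.app]
    module
  add {V V'} hV hV' := by
    have h : J.app (V + V') = J.app V + J.app V' := by
      funext q
      simp [EndoField.app]
    ext x
    simp [h, nabla.isCovariantDerivativeOnUniv.add hV hV',
      nabla.isCovariantDerivativeOnUniv.add (J.mdiffAt_app hV) (J.mdiffAt_app hV')]
    abel

/-- The covariant derivative `∇J` of a `(1,1)`-tensor field `J`:
`(∇_x J) v = ∇_x (J V) - J ∇_x V` for any vector field `V` with value `v` at `p`. The argument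
order is `J.covDeriv ∇ p v x = (∇_x J) v`. -/
def EndoField.covDeriv [FiniteDimensional ℝ E] [IsManifold I ∞ M] (J : EndoField I M)
    (nabla : CovariantDerivative I E (TangentSpace I : M → Type _)) (p : M) :
    TangentSpace I p →L[ℝ] TangentSpace I p →L[ℝ] TangentSpace I p :=
  TensorialAt.mkHom (fun V : Π q : M, TangentSpace I q ↦
    nabla (J.app V) p - J.toFun p ∘L nabla V p) p (tensorialAt_covDeriv nabla J p)

variable [FiniteDimensional ℝ E] [IsManifold I ∞ M]

/-- The tensor `z ↦ (y ↦ Q(y, z))`, `Q(y, z) = ¼ ∑_α (∇_y J_α) J_α z`. -/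
def AlmostHG.Q (S : AlmostHG I M)
    (nabla : CovariantDerivative I E (TangentSpace I : M → Type _)) (p : M) :
    TangentSpace I p →L[ℝ] TangentSpace I p →L[ℝ] TangentSpace I p :=
  (1 / 4 : ℝ) • ∑ α : Fin 3, (S.J α).covDeriv nabla p ∘L (S.J α).toFun p

/-- The connection `D_y z = ∇_y z + Q(y, z)`. -/
def AlmostHG.D (S : AlmostHG I M)
    (nabla : CovariantDerivative I E (TangentSpace I : M → Type _)) :
    CovariantDerivative I E (TangentSpace I : M → Type _) :=
  nabla.addOneForm (S.Q nabla)

/-- The curvature `∇_X ∇_Y Z - ∇_Y ∇_X Z - ∇_[X,Y] Z` of a linear connection. -/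
def curvature (nabla : CovariantDerivative I E (TangentSpace I : M → Type _))
    (X Y Z : Π p : M, TangentSpace I p) (p : M) : TangentSpace I p :=
  nabla (fun q ↦ nabla Z q (Y q)) p (X p) - nabla (fun q ↦ nabla Z q (X q)) p (Y p)
    - nabla Z p (VectorField.mlieBracket I X Y p)

/-- The curvature as a function of four vector fields: `g(R(X, Y) Z, W)`. -/
def curvature₄ (g : PseudoMetric I M)
    (nabla : CovariantDerivative I E (TangentSpace I : M → Type _))
    (X Y Z W : Π p : M, TangentSpace I p) (p : M) : ℝ :=
  g.toFun p (curvature nabla X Y Z p) (W p)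

/-- `(L ∘ J)(X, Y, Z, W) = L(X, Y, J Z, J W)`. -/
def compJ (L : (X Y Z W : Π p : M, TangentSpace I p) → M → ℝ) (J : EndoField I M) :
    (X Y Z W : Π p : M, TangentSpace I p) → M → ℝ :=
  fun X Y Z W ↦ L X Y (J.app Z) (J.app W)

/-- `P_{αβ}(x, y, z, w) = g((∇_x J_α) J_α z, (∇_y J_β) J_β w)
- g((∇_y J_α) J_α z, (∇_x J_β) J_β w)`. -/
def AlmostHG.Pαβ (S : AlmostHG I M)
    (nabla : CovariantDerivative I E (TangentSpace I : M → Type _)) (α β : Fin 3) (p : M)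
    (x y z w : TangentSpace I p) : ℝ :=
  S.g.toFun p ((S.J α).covDeriv nabla p ((S.J α).toFun p z) x)
      ((S.J β).covDeriv nabla p ((S.J β).toFun p w) y)
    - S.g.toFun p ((S.J α).covDeriv nabla p ((S.J α).toFun p z) y)
      ((S.J β).covDeriv nabla p ((S.J β).toFun p w) x)

/-- `P = ∑_{α,β} P_{αβ} - 4 ∑_α P_{αα}`. -/
def AlmostHG.P (S : AlmostHG I M)
    (nabla : CovariantDerivative I E (TangentSpace I : M → Type _)) (p : M)
    (x y z w : TangentSpace I p) : ℝ :=
  (∑ α : Fin 3, ∑ β : Fin 3, S.Pαβ nabla α β p x y z w)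
    - 4 * ∑ α : Fin 3, S.Pαβ nabla α α p x y z w

end HGManifold

end

namespace HGManifold

section

variable {E : Type*} [NormedAddCommGroup E] [NormedSpace ℝ E]
  {H : Type*} [TopologicalSpace H] {I : ModelWithCorners ℝ E H}
  {M : Type*} [TopologicalSpace M] [ChartedSpace H M] [IsManifold I ∞ M]

/-! Put `A_α = (∇J_α)J_α`. The conjugate connection `J_α⁻¹ ∇ J_α` equals `∇ + A_α` and has curvature
`J_α⁻¹ R J_α`, so `D` is the mean of four connections: `∇` and its three conjugates
(`D_apply_eq_mean`). Curvature is affine in the connection up to a quadratic term, hence `K` is the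
mean of the four curvatures plus `1/16` of `∑ [A_β, A_α] - 4 ∑ [A_α, A_α]`, antisymmetrized in `X,
Y` (`curvature_D`).

Each `J_α` preserves `g` up to the constant `ε_α`, so `∇` and its conjugate are both metric and
their difference `A_α` is skew-adjoint (`covDerivJ_skew`). Pairing with `W` and moving the outer
factor across `g` turns the quadratic term into `P`; moving `J_α` across gives the signs `ε_α`. -/

theorem EndoField.isSmoothOn_app (J : EndoField I M) {V : Π p : M, TangentSpace I p} {U : Set M}
    (hV : IsSmoothOn I V U) : IsSmoothOn I (J.app V) U :=
  ContMDiffOn.clm_bundle_apply (b := fun q : M ↦ q) J.smooth.contMDiffOn hV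

theorem IsSmoothOn.mdiffAt {V : Π p : M, TangentSpace I p} {U : Set M}
    (hV : IsSmoothOn I V U) (hU : IsOpen U) {p : M} (hp : p ∈ U) : MDiffAt (T% V) p :=
  (hV.contMDiffAt (hU.mem_nhds hp)).mdifferentiableAt (by simp)

@[simp]
theorem AlmostHG.J_J (S : AlmostHG I M) (α : Fin 3) (p : M) (v : TangentSpace I p) :
    (S.J α).toFun p ((S.J α).toFun p v) = -v :=
  DFunLike.congr_fun (S.J_sq α p) v

theorem AlmostHG.J_app_J_app (S : AlmostHG I M) (α : Fin 3) (V : Π p : M, TangentSpace I p) :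
    (S.J α).app ((S.J α).app V) = (-1 : ℝ) • V := by
  funext q
  simp [EndoField.app]

variable [FiniteDimensional ℝ E]

/-- The vector field `∇_Y Z` is smooth if `Y` and `Z` are. -/
theorem IsLeviCivita.isSmoothOn {g : PseudoMetric I M}
    {nabla : CovariantDerivative I E (TangentSpace I : M → Type _)} (h : IsLeviCivita g nabla)
    {Y Z : Π p : M, TangentSpace I p} {U : Set M} (hU : IsOpen U)
    (hY : IsSmoothOn I Y U) (hZ : IsSmoothOn I Z U) :
    IsSmoothOn I (fun q ↦ nabla Z q (Y q)) U :=
  ContMDiffOn.clm_bundle_apply (b := fun q : M ↦ q) ((h.smooth U hU).contMDiff hZ) hY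

theorem EndoField.covDeriv_apply (J : EndoField I M)
    (nabla : CovariantDerivative I E (TangentSpace I : M → Type _))
    {V : Π p : M, TangentSpace I p} {p : M} (hV : MDiffAt (T% V) p) (x : TangentSpace I p) :
    J.covDeriv nabla p (V p) x = nabla (J.app V) p x - J.toFun p (nabla V p x) := by
  rw [EndoField.covDeriv, TensorialAt.mkHom_apply _ hV]
  rfl

namespace AlmostHG

variable (S : AlmostHG I M) (nabla : CovariantDerivative I E (TangentSpace I : M → Type _))

/-- The tensor `(∇_x J_α) J_α v`, as a function of `v` and `x`. -/
noncomputable def covDerivJ (α : Fin 3) (p : M) :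
    TangentSpace I p →L[ℝ] TangentSpace I p →L[ℝ] TangentSpace I p :=
  (S.J α).covDeriv nabla p ∘L (S.J α).toFun p

/-- Since `-J_α = J_α⁻¹`, this identifies `A_α` with the difference `J_α⁻¹ ∇ J_α - ∇`. -/
theorem covDerivJ_apply (α : Fin 3) {V : Π p : M, TangentSpace I p} {p : M}
    (hV : MDiffAt (T% V) p) (x : TangentSpace I p) :
    S.covDerivJ nabla α p (V p) x
      = -nabla V p x - (S.J α).toFun p (nabla ((S.J α).app V) p x) := by
  have h := (S.J α).covDeriv_apply nabla ((S.J α).mdiffAt_app hV) x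
  rw [J_app_J_app, nabla.isCovariantDerivativeOnUniv.smul_const _ hV] at h
  simpa [covDerivJ, EndoField.app] using h

theorem nabla_J_app (α : Fin 3) {V : Π p : M, TangentSpace I p} {p : M}
    (hV : MDiffAt (T% V) p) (x : TangentSpace I p) :
    nabla ((S.J α).app V) p x = (S.J α).toFun p (nabla V p x)
      - S.covDerivJ nabla α p ((S.J α).app V p) x := by
  simp [covDerivJ, EndoField.app, (S.J α).covDeriv_apply nabla hV x]

theorem D_apply (V : Π p : M, TangentSpace I p) (p : M) (x : TangentSpace I p) :
    S.D nabla V p x = nabla V p x + (1 / 4 : ℝ) • ∑ α, S.covDerivJ nabla α p (V p) x := by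
  change nabla V p x + S.Q nabla p (V p) x = _
  simp only [Q, Fin.sum_univ_three]
  rfl

/-- `D` is the mean of `∇` and its conjugates by `J₁, J₂, J₃`. -/
theorem D_apply_eq_mean {V : Π p : M, TangentSpace I p} {p : M} (hV : MDiffAt (T% V) p)
    (x : TangentSpace I p) :
    S.D nabla V p x = (1 / 4 : ℝ) •
      (nabla V p x - ∑ α, (S.J α).toFun p (nabla ((S.J α).app V) p x)) := by
  simp only [D_apply, S.covDerivJ_apply nabla _ hV, Fin.sum_univ_three]
  module

variable {nabla}

/-- `(∇_x J_α) J_α` is skew-adjoint. -/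
theorem covDerivJ_skew (h : IsLeviCivita S.g nabla) (α : Fin 3) {p : M}
    (x v w : TangentSpace I p) :
    S.g.toFun p (S.covDerivJ nabla α p v x) w = -S.g.toFun p v (S.covDerivJ nabla α p w x) := by
  obtain ⟨V, hV, rfl⟩ : ∃ V : Π p : M, TangentSpace I p, MDiffAt (T% V) p ∧ V p = v :=
    ⟨FiberBundle.extend E v, FiberBundle.mdifferentiableAt_extend .., by simp⟩
  obtain ⟨W, hW, rfl⟩ : ∃ W : Π p : M, TangentSpace I p, MDiffAt (T% W) p ∧ W p = w :=
    ⟨FiberBundle.extend E w, FiberBundle.mdifferentiableAt_extend .., by simp⟩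
  have hJV := (S.J α).mdiffAt_app hV
  have hJW := (S.J α).mdiffAt_app hW
  -- Differentiating both expressions for the same function by metricity compares `∇` with its
  -- conjugate; `ε_α` is absorbed into the second field so that the rule applies verbatim.
  have hfun : S.g.app V W
      = S.g.app ((S.J α).app V) (epsilon α • (S.J α).app W) := by
    funext q
    simpa [PseudoMetric.app, EndoField.app] using S.g_J α q (V q) (W q)
  have hsmul : MDiffAt (T% (epsilon α • (S.J α).app W)) p := by
    exact mdifferentiableAt_const.smul_section hJW
  have h₁ := h.metric p V W hV hW x
  rw [hfun, h.metric p _ _ hJV hsmul x,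
    nabla.isCovariantDerivativeOnUniv.smul_const _ hJW] at h₁
  have h₂ := S.g_J α p ((S.J α).toFun p (nabla ((S.J α).app V) p x)) (W p)
  have h₃ := S.g_J α p (V p) ((S.J α).toFun p (nabla ((S.J α).app W) p x))
  simp only [S.covDerivJ_apply nabla α hV, S.covDerivJ_apply nabla α hW]
  simp [EndoField.app] at h₁ h₂ h₃ ⊢
  linarith

/-- The curvature of `D` is the mean of those of `∇` and its conjugates, up to a quadratic term. -/
theorem curvature_D (h : IsLeviCivita S.g nabla) {U : Set M} (hU : IsOpen U)
    {X Y Z : Π p : M, TangentSpace I p} (hX : IsSmoothOn I X U) (hY : IsSmoothOn I Y U)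
    (hZ : IsSmoothOn I Z U) {p : M} (hp : p ∈ U) :
    curvature (S.D nabla) X Y Z p =
      (1 / 4 : ℝ) • (curvature nabla X Y Z p
        - ∑ α, (S.J α).toFun p (curvature nabla X Y ((S.J α).app Z) p))
      + (1 / 16 : ℝ) • (∑ β, ∑ α,
          (S.covDerivJ nabla β p (S.covDerivJ nabla α p (Z p) (Y p)) (X p)
            - S.covDerivJ nabla β p (S.covDerivJ nabla α p (Z p) (X p)) (Y p))
        - (4 : ℝ) • ∑ α,
          (S.covDerivJ nabla α p (S.covDerivJ nabla α p (Z p) (Y p)) (X p)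
            - S.covDerivJ nabla α p (S.covDerivJ nabla α p (Z p) (X p)) (Y p))) := by
  -- The outer `D` acts on the inner derivative written as a mean, so no derivative of `A_α` ever
  -- appears.
  have key {Y : Π p : M, TangentSpace I p} (hY : IsSmoothOn I Y U) (x : TangentSpace I p) :
      S.D nabla (fun q ↦ S.D nabla Z q (Y q)) p x =
        (1 / 4 : ℝ) • (nabla (fun q ↦ nabla Z q (Y q)) p x
          - ∑ α, (S.J α).toFun p (nabla (fun q ↦ nabla ((S.J α).app Z) q (Y q)) p x))
        + (1 / 16 : ℝ) • (∑ β, ∑ α, S.covDerivJ nabla β p (S.covDerivJ nabla α p (Z p) (Y p)) x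
          - (4 : ℝ) • ∑ α, S.covDerivJ nabla α p (S.covDerivJ nabla α p (Z p) (Y p)) x) := by
    set V : Π q : M, TangentSpace I q := fun q ↦ nabla Z q (Y q) with hV
    set T : Fin 3 → Π q : M, TangentSpace I q :=
      fun α q ↦ nabla ((S.J α).app Z) q (Y q) with hT
    have hVp : MDiffAt (T% V) p := (h.isSmoothOn hU hY hZ).mdiffAt hU hp
    have hTp (α) : MDiffAt (T% (T α)) p :=
      (h.isSmoothOn hU hY ((S.J α).isSmoothOn_app hZ)).mdiffAt hU hp
    have hJTp (α) : MDiffAt (T% ((S.J α).app (T α))) p := (S.J α).mdiffAt_app (hTp α)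
    have hJT (α) : (S.J α).app (T α) p = -V p - S.covDerivJ nabla α p (Z p) (Y p) := by
      rw [S.covDerivJ_apply nabla α (hZ.mdiffAt hU hp)]
      simp [hV, hT, EndoField.app]
    set F : Π q : M, TangentSpace I q := (1 / 4 : ℝ) • (V + ((-1 : ℝ) • (S.J 0).app (T 0)
      + ((-1 : ℝ) • (S.J 1).app (T 1) + (-1 : ℝ) • (S.J 2).app (T 2)))) with hF
    have hsmul (c : ℝ) {V : Π q : M, TangentSpace I q} (hV : MDiffAt (T% V) p) :
        MDiffAt (T% (c • V)) p := mdifferentiableAt_const.smul_section hV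
    have h₂ := mdifferentiableAt_add_section (hsmul (-1) (hJTp 1)) (hsmul (-1) (hJTp 2))
    have h₁ := mdifferentiableAt_add_section (hsmul (-1) (hJTp 0)) h₂
    have h₀ := mdifferentiableAt_add_section hVp h₁
    -- The mean formula needs `Z` differentiable, so it holds only on `U`; the germ at `p` is enough
    -- for `D`.
    have hev : ∀ᶠ q in 𝓝 p, S.D nabla Z q (Y q) = F q := by
      filter_upwards [hU.mem_nhds hp] with q hq
      rw [S.D_apply_eq_mean nabla (hZ.mdiffAt hU hq), Fin.sum_univ_three]
      simp only [hF, hV, hT, EndoField.app, Pi.smul_apply, Pi.add_apply]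
      module
    have hFp : MDiffAt (T% F) p := hsmul _ h₀
    have hDp : MDiffAt (T% (fun q ↦ S.D nabla Z q (Y q))) p :=
      hFp.congr_of_eventuallyEq (hev.mono fun q hq ↦ by simp [hq])
    have hD := (S.D nabla).isCovariantDerivativeOnUniv
    rw [hD.congr_of_eventuallyEq hDp hFp Filter.univ_mem hev, hF, hD.smul_const _ h₀,
      hD.add hVp h₁, hD.add (hsmul _ (hJTp 0)) h₂, hD.add (hsmul _ (hJTp 1)) (hsmul _ (hJTp 2)),
      hD.smul_const _ (hJTp 0), hD.smul_const _ (hJTp 1), hD.smul_const _ (hJTp 2)]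
    simp only [add_apply, smul_apply, D_apply,
      S.nabla_J_app nabla _ (hTp _), hJT, Fin.sum_univ_three, map_sub, map_neg,
      sub_apply, neg_apply]
    -- Inside the overall factor `1/4`, each `A_α V` has coefficient `1/4 + 3/4 - 1 = 0`, so only
    -- products of two `A`'s survive.
    module
  have hZp := hZ.mdiffAt hU hp
  -- The bracket term is first order in `Z`, so the mean formula handles it with no quadratic
  -- correction.
  simp only [curvature, key hX, key hY, S.D_apply_eq_mean nabla hZp, Fin.sum_univ_three,
    map_sub]
  module

end AlmostHG

end

end HGManifold

/-- The curvatures of `D` and of the Levi-Civita connection on an almost `(H,G)`-manifold of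
dimension `4n`, evaluated on arbitrary local smooth vector fields. -/
theorem proposition8 {n : ℕ} {M : Type*} [TopologicalSpace M]
    [ChartedSpace (EuclideanSpace ℝ (Fin (4 * n))) M] [IsManifold (𝓡 (4 * n)) ∞ M]
    (S : HGManifold.AlmostHG (𝓡 (4 * n)) M)
    (nabla : CovariantDerivative (𝓡 (4 * n)) (EuclideanSpace ℝ (Fin (4 * n)))
      (TangentSpace (𝓡 (4 * n)) : M → Type _))
    (hnabla : HGManifold.IsLeviCivita S.g nabla)
    (U : Set M) (hU : IsOpen U) (X Y Z W : Π p : M, TangentSpace (𝓡 (4 * n)) p)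
    (hX : HGManifold.IsSmoothOn (𝓡 (4 * n)) X U) (hY : HGManifold.IsSmoothOn (𝓡 (4 * n)) Y U)
    (hZ : HGManifold.IsSmoothOn (𝓡 (4 * n)) Z U) (hW : HGManifold.IsSmoothOn (𝓡 (4 * n)) W U)
    (p : M) (hp : p ∈ U) :
    HGManifold.curvature₄ S.g (S.D nabla) X Y Z W p =
      (1 / 4 : ℝ) * (HGManifold.curvature₄ S.g nabla X Y Z W p
        + HGManifold.compJ (HGManifold.curvature₄ S.g nabla) (S.J 0) X Y Z W p
        - HGManifold.compJ (HGManifold.curvature₄ S.g nabla) (S.J 1) X Y Z W p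
        - HGManifold.compJ (HGManifold.curvature₄ S.g nabla) (S.J 2) X Y Z W p)
      + (1 / 16 : ℝ) * S.P nabla p (X p) (Y p) (Z p) (W p) := by
  have hskew (β α : Fin 3) (x y : TangentSpace (𝓡 (4 * n)) p) :
      S.g.toFun p (S.covDerivJ nabla β p (S.covDerivJ nabla α p (Z p) y) x) (W p)
        = -S.g.toFun p (S.covDerivJ nabla α p (Z p) y) (S.covDerivJ nabla β p (W p) x) :=
    S.covDerivJ_skew hnabla β x _ _
  -- The `J_α`-compatibility of `g` together with `J_α² = -1`; this minus sign cancels the one in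
  -- front of the conjugated curvatures, leaving `ε_α`.
  have hJ (α : Fin 3) (v : TangentSpace (𝓡 (4 * n)) p) :
      S.g.toFun p ((S.J α).toFun p v) (W p)
        = -(HGManifold.epsilon α * S.g.toFun p v ((S.J α).toFun p (W p))) := by
    rw [S.g_J α]
    simp
  have hP (α β : Fin 3) : S.Pαβ nabla α β p (X p) (Y p) (Z p) (W p) =
      S.g.toFun p (S.covDerivJ nabla α p (Z p) (X p)) (S.covDerivJ nabla β p (W p) (Y p))
        - S.g.toFun p (S.covDerivJ nabla α p (Z p) (Y p)) (S.covDerivJ nabla β p (W p) (X p)) :=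
    rfl
  simp only [HGManifold.curvature₄, S.curvature_D hnabla hU hX hY hZ hp, HGManifold.compJ,
    HGManifold.AlmostHG.P, hP, Fin.sum_univ_three, map_add, map_sub, map_smul,
    add_apply, sub_apply, smul_apply,
    smul_eq_mul, hskew, hJ, HGManifold.EndoField.app]
  simp only [HGManifold.epsilon, Matrix.cons_val]
  ring
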